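/- For integers $n, k$, let $I(n,k)$ denote the number of intersecting $k$-uniform hypergraphs on the vertex set $[n] = \{1,\dots,n\}$, that is, the number of families $\mathcal{H}$ (the empty family included) of $k$-element subsets of $[n]$ such that $E \cap F \neq \emptyset$ for all $E, F \in \mathcal{H}$. Then, for $k \ge 3$ and $n \ge 2k+1$, \[ \log_2 I(n,k) = (1 + o(1)) \binom{n-1}{k-1}, \] where $o(1)$ denotes a quantity that tends to $0$ as $n \to \infty$, uniformly in $k$. In other words, for every $\varepsilon > 0$ there is an integer $n_0$ such that for all integers $n \ge n_0$ and all integers $k$ with $k \ge 3$ and $n \ge 2k+1$, \[ \left| \log_2 I(n,k) - \binom{n-1}{k-1} \right| \le \varepsilon \binom{n-1}{k-1}. \] -/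

import Mathlib

/-- `numIntersecting n k` is the number `I(n, k)` of intersecting `k`-uniform hypergraphs on the
vertex set `[n]`, modelled as `Fin n`.  A hypergraph on `[n]` is given by its (finite) set of edges:
`Set.Sized k` says that every edge has exactly `k` vertices, and `Set.Intersecting` says that any
two edges have a vertex in common.  The edgeless hypergraph is counted. -/
noncomputable def numIntersecting (n k : ℕ) : ℕ :=
  Set.ncard {H : Finset (Finset (Fin n)) |
    (H : Set (Finset (Fin n))).Sized k ∧ (H : Set (Finset (Fin n))).Intersecting}

/-! Intersecting families are the independent sets of the Kneser graph on `k`-sets, with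
disjointness as adjacency. Write M = C(n-1,k-1). The 2^M subfamilies of a star give the lower bound.

The upper bound needs supersaturation. Averaging Katona's cycle argument over all permutations
(`sum_arcs_le`) shows that a family of s > M sets spans at least (s-M)·C(n-k,k-1)/k ordered disjoint
pairs. Hence a family larger than (1+η)M has a member disjoint from order n²/k others
(`exists_large_degree`).

Branching on such vertices until at most (1+η)M remain gives at most 2^((1+η)M)·(1+t)^C(n,k)
independent sets (`card_independent_le`). With t a small multiple of k/n, the second factor
contributes only O(tC(n,k)), a small multiple of M, to the logarithm. -/

open scoped Pointwise

/-! ### Transitive actions and disjoint pairs -/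

/-- Double counting over a transitive action on a finite set. -/
theorem card_mul_sum_smul {G β : Type*} [Group G] [Fintype G] [MulAction G β] (O : Finset β)
    (hinv : ∀ g : G, ∀ x ∈ O, g • x ∈ O) (htrans : ∀ x ∈ O, ∀ y ∈ O, ∃ g : G, g • x = y)
    (f : β → ℕ) {x : β} (hx : x ∈ O) :
    O.card * ∑ g : G, f (g • x) = Fintype.card G * ∑ y ∈ O, f y := by
  have h1 : ∀ y ∈ O, ∑ g : G, f (g • y) = ∑ g : G, f (g • x) := by
    intro y hy
    obtain ⟨h, rfl⟩ := htrans x hx y hy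
    simp_rw [← mul_smul]
    exact Fintype.sum_equiv (Equiv.mulRight h) _ (fun g => f (g • x)) fun g => rfl
  have h2 : ∀ g : G, ∑ y ∈ O, f (g • y) = ∑ y ∈ O, f y := by
    intro g
    refine Finset.sum_bij' (fun y _ => g • y) (fun y _ => g⁻¹ • y) ?_ ?_ ?_ ?_ ?_
    · exact fun y hy => hinv g y hy
    · exact fun y hy => hinv g⁻¹ y hy
    · simp
    · simp
    · simp
  calc O.card * ∑ g : G, f (g • x) = ∑ y ∈ O, ∑ g : G, f (g • y) := by
        rw [Finset.sum_congr rfl h1, Finset.sum_const, smul_eq_mul]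
    _ = ∑ g : G, ∑ y ∈ O, f (g • y) := Finset.sum_comm
    _ = Fintype.card G * ∑ y ∈ O, f y := by
        rw [Finset.sum_congr rfl fun g _ => h2 g]; simp

/-- The ordered pairs of disjoint `k`-element subsets. -/
def disjointPairs (α : Type*) [Fintype α] [DecidableEq α] (k : ℕ) :
    Finset (Finset α × Finset α) :=
  {p | p.1.card = k ∧ p.2.card = k ∧ Disjoint p.1 p.2}

theorem mem_disjointPairs {α : Type*} [Fintype α] [DecidableEq α] {k : ℕ}
    {p : Finset α × Finset α} :
    p ∈ disjointPairs α k ↔ p.1.card = k ∧ p.2.card = k ∧ Disjoint p.1 p.2 := by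
  simp [disjointPairs]

theorem card_disjointPairs (α : Type*) [Fintype α] [DecidableEq α] (k : ℕ) :
    (disjointPairs α k).card =
      (Fintype.card α).choose k * (Fintype.card α - k).choose k := by
  have : disjointPairs α k = ((Finset.univ : Finset α).powersetCard k).biUnion
      (fun A => (Aᶜ.powersetCard k).image (fun B => (A, B))) := by
    ext ⟨A, B⟩
    simp only [mem_disjointPairs, Finset.mem_biUnion, Finset.mem_powersetCard, Finset.mem_image,
      Prod.mk.injEq, Finset.subset_univ, true_and, Finset.subset_compl_iff_disjoint_left]
    constructor
    · rintro ⟨h1, h2, h3⟩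
      exact ⟨A, h1, B, ⟨h3, h2⟩, rfl, rfl⟩
    · rintro ⟨A, h1, B, ⟨h3, h2⟩, rfl, rfl⟩
      exact ⟨h1, h2, h3⟩
  rw [this, Finset.card_biUnion]
  · rw [Finset.sum_congr rfl (g := fun _ => (Fintype.card α - k).choose k)]
    · simp
    · intro A hA
      rw [Finset.card_image_of_injective _ (Prod.mk_right_injective A), Finset.card_powersetCard,
        Finset.card_compl, (Finset.mem_powersetCard.1 hA).2]
  · intro A _ A' _ hne
    rw [Function.onFun, Finset.disjoint_left]
    rintro p hp hp'
    obtain ⟨B, -, rfl⟩ := Finset.mem_image.1 hp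
    obtain ⟨B', -, h⟩ := Finset.mem_image.1 hp'
    exact hne (Prod.mk.inj h).1.symm

/-- Any two pairs of disjoint sets with matching cardinalities differ by a permutation. -/
theorem exists_perm_smul_pair {α : Type*} [Fintype α] [DecidableEq α] {A B A' B' : Finset α}
    (hA : A.card = A'.card) (hB : B.card = B'.card) (h : Disjoint A B) (h' : Disjoint A' B') :
    ∃ σ : Equiv.Perm α, σ • A = A' ∧ σ • B = B' := by
  -- Colour points by membership in the two sets. Corresponding colour classes have equal size, and
  -- bijections between them glue to the permutation.
  have hcol : ∀ c : Prop × Prop,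
      Nonempty ({x // ((x ∈ A, x ∈ B) : Prop × Prop) = c} ≃
        {x // ((x ∈ A', x ∈ B') : Prop × Prop) = c}) := by
    intro c
    classical
    refine ⟨Fintype.equivOfCardEq ?_⟩
    have key : ∀ C D : Finset α, Disjoint C D →
        Fintype.card {x // ((x ∈ C, x ∈ D) : Prop × Prop) = c} =
          if c.1 then (if c.2 then 0 else C.card) else
            (if c.2 then D.card else Fintype.card α - (C.card + D.card)) := by
      intro C D hCD
      rw [← Finset.card_union_of_disjoint hCD, ← Finset.card_compl, Fintype.card_subtype]
      obtain ⟨p, q⟩ := c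
      have hd := Finset.disjoint_left.1 hCD
      split_ifs with h1 h2 h2 <;> simp only at h1 h2 <;>
        simp only [Prod.mk.injEq, h1, h2, eq_iff_iff, iff_true, iff_false, Finset.card_eq_zero]
      · ext x; simpa using @hd x
      · congr 1; ext x; simpa using @hd x
      · congr 1; ext x; simpa using fun a b => hd b a
      · congr 1; ext x; simp
    rw [key A B h, key A' B' h', hA, hB]
  let e := fun c => (hcol c).some
  let σ : Equiv.Perm α := Equiv.ofFiberEquiv e
  have hσ : ∀ x, ((σ x ∈ A', σ x ∈ B') : Prop × Prop) = (x ∈ A, x ∈ B) :=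
    fun x => Equiv.ofFiberEquiv_map e x
  simp only [Prod.mk.injEq, eq_iff_iff] at hσ
  refine ⟨σ, ?_, ?_⟩
  · ext y
    rw [← Finset.inv_smul_mem_iff, ← (hσ (σ⁻¹ • y)).1]
    simp [Equiv.Perm.smul_def]
  · ext y
    rw [← Finset.inv_smul_mem_iff, ← (hσ (σ⁻¹ • y)).2]
    simp [Equiv.Perm.smul_def]

/-- If every set of more than `k` vertices spans an edge, then a set `T` spans at least
`T.card - k` edges. -/
theorem card_le_add_card_edges {ι : Type*} [DecidableEq ι] (r : ι → ι → Prop) [DecidableRel r]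
    {k : ℕ} (h : ∀ T : Finset ι, k < T.card → ∃ i ∈ T, ∃ j ∈ T, r i j) (T : Finset ι) :
    T.card ≤ k + ((T ×ˢ T).filter fun p => r p.1 p.2).card := by
  induction T using Finset.strongInduction with
  | H T ih =>
    by_cases hT : T.card ≤ k
    · omega
    obtain ⟨i, hi, j, hj, hij⟩ := h T (by omega)
    have h1 := ih _ (Finset.erase_ssubset hi)
    have h2 : ((T.erase i ×ˢ T.erase i).filter fun p => r p.1 p.2).card <
        ((T ×ˢ T).filter fun p => r p.1 p.2).card := by
      apply Finset.card_lt_card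
      refine (Finset.ssubset_iff_of_subset ?_).2 ⟨(i, j), ?_, ?_⟩
      · exact Finset.filter_subset_filter _
          (Finset.product_subset_product (Finset.erase_subset _ _) (Finset.erase_subset _ _))
      · simp [hi, hj, hij]
      · simp
    rw [Finset.card_erase_of_mem hi] at h1
    omega

/-! ### Katona's cyclic intervals -/

/-- The cyclic interval of length `k` starting at `i`. -/
def arc {n : ℕ} (k : ℕ) (i : Fin n) : Finset (Fin n) :=
  {x | (x - i).val < k}

theorem fin_val_sub_eq {n : ℕ} (a b : Fin n) :
    (a - b).val = if b.val ≤ a.val then a.val - b.val else n + a.val - b.val := by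
  have ha := a.isLt
  have hb := b.isLt
  rw [Fin.sub_def]
  simp only
  split_ifs with h
  · rw [show n - b.val + a.val = (a.val - b.val) + n by omega, Nat.add_mod_right,
      Nat.mod_eq_of_lt (by omega)]
  · rw [Nat.mod_eq_of_lt (by omega)]
    omega

theorem card_filter_fin_val {n : ℕ} (p : ℕ → Prop) [DecidablePred p] (i : Fin n) :
    (Finset.univ.filter fun x : Fin n => p (x - i).val).card = ((Finset.range n).filter p).card := by
  have : NeZero n := ⟨by have := i.isLt; omega⟩
  refine Finset.card_bij (fun x _ => (x - i).val) ?_ ?_ ?_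
  · intro x hx
    simpa using hx
  · intro x _ y _ hxy
    exact sub_left_injective (Fin.val_injective hxy)
  · intro d hd
    simp only [Finset.mem_filter, Finset.mem_range] at hd
    refine ⟨⟨d, hd.1⟩ + i, ?_, ?_⟩ <;> simp [hd.2]

theorem card_arc {n k : ℕ} (hk : k ≤ n) (i : Fin n) : (arc k i).card = k := by
  rw [arc, card_filter_fin_val (fun d => d < k)]
  rw [show (Finset.range n).filter (fun d => d < k) = Finset.range k by ext; simp; omega]
  simp

theorem disjoint_arc_iff {n k : ℕ} (hk : 0 < k) (hkn : k ≤ n) (i j : Fin n) :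
    Disjoint (arc k i) (arc k j) ↔ k ≤ (j - i).val ∧ (j - i).val ≤ n - k := by
  have hi := i.isLt
  have hj := j.isLt
  rw [Finset.disjoint_left]
  simp only [arc, Finset.mem_filter, Finset.mem_univ, true_and]
  constructor
  · intro h
    have h1 := @h i
    have h2 := @h j
    simp only [fin_val_sub_eq] at *
    split_ifs at * <;> omega
  · intro h x
    have hx := x.isLt
    simp only [fin_val_sub_eq] at *
    split_ifs at * <;> omega

/-- Katona's lemma: among more than `k` cyclic intervals of length `k` two are disjoint. -/
theorem exists_disjoint_arc {n k : ℕ} (hk : 0 < k) (hkn : 2 * k ≤ n) (T : Finset (Fin n))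
    (hT : k < T.card) : ∃ i ∈ T, ∃ j ∈ T, Disjoint (arc k i) (arc k j) := by
  by_contra! hcon
  obtain ⟨i₀, hi₀⟩ := Finset.card_pos.1 (by omega : 0 < T.card)
  simp only [disjoint_arc_iff hk (by omega : k ≤ n)] at hcon
  have hT' : T.card ≤ (Finset.range k).card := by
    -- A start at distance at least `k` lies beyond `n - k`. A collision means two starts `n - k`
    -- apart, whose arcs are disjoint.
    refine Finset.card_le_card_of_injOn
      (fun j => if (j - i₀).val < k then (j - i₀).val else (j - i₀).val - (n - k)) ?_ ?_
    · intro j hj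
      have h1 := hcon i₀ hi₀ j hj
      have h2 := (j - i₀).isLt
      simp only [Finset.coe_range, Set.mem_Iio]
      split_ifs <;> omega
    · intro j hj j' hj' h
      have h1 := hcon i₀ hi₀ j hj
      have h2 := hcon i₀ hi₀ j' hj'
      have h3 := hcon j hj j' hj'
      have h4 := hcon j' hj' j hj
      have := j.isLt
      have := j'.isLt
      have := i₀.isLt
      apply Fin.ext
      simp only [fin_val_sub_eq] at *
      split_ifs at * <;> omega
  simp at hT'
  omega

theorem card_disjoint_arcs {n k : ℕ} (hk : 0 < k) (hkn : 2 * k ≤ n) :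
    (Finset.univ.filter fun p : Fin n × Fin n => Disjoint (arc k p.1) (arc k p.2)).card =
      n * (n - 2 * k + 1) := by
  rw [← Finset.univ_product_univ, Finset.card_filter, Finset.sum_product]
  simp only [disjoint_arc_iff hk (by omega : k ≤ n), ← Finset.card_filter]
  rw [Finset.sum_congr rfl (g := fun _ => n - 2 * k + 1)]
  · simp
  · intro i _
    rw [card_filter_fin_val (fun d => k ≤ d ∧ d ≤ n - k)]
    rw [show (Finset.range n).filter (fun d => k ≤ d ∧ d ≤ n - k) = Finset.Icc k (n - k) by
      ext; simp; omega]
    simp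
    omega

/-! ### Supersaturation -/

/-- The number of ordered disjoint pairs spanned by a family. -/
def numDisjoint {α : Type*} [DecidableEq α] (S : Finset (Finset α)) : ℕ :=
  ((S ×ˢ S).filter fun p => Disjoint p.1 p.2).card

/-- Averaging the bound for cyclic intervals over all permutations of the ground set. -/
theorem sum_arcs_le {n k : ℕ} (hk : 0 < k) (hkn : 2 * k ≤ n) (S : Finset (Finset (Fin n)))
    (hS : ∀ A ∈ S, A.card = k) :
    n * S.card * (n - k).choose k ≤
      k * (n.choose k * (n - k).choose k) + n * (n - 2 * k + 1) * numDisjoint S := by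
  classical
  set N := n.choose k
  set c := (n - k).choose k
  let P := Finset.univ.filter fun p : Fin n × Fin n => Disjoint (arc k p.1) (arc k p.2)
  have hP : P.card = n * (n - 2 * k + 1) := card_disjoint_arcs hk hkn
  have hcardG : 0 < Fintype.card (Equiv.Perm (Fin n)) := Fintype.card_pos
  set F := Fintype.card (Equiv.Perm (Fin n))
  let f : Finset (Fin n) → ℕ := fun A => if A ∈ S then 1 else 0
  let g : Finset (Fin n) × Finset (Fin n) → ℕ := fun p => if p.1 ∈ S ∧ p.2 ∈ S then 1 else 0
  have key : ∀ σ : Equiv.Perm (Fin n),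
      ∑ i, f (σ • arc k i) ≤ k + ∑ p ∈ P, g (σ • (arc k p.1, arc k p.2)) := by
    intro σ
    have h := card_le_add_card_edges (fun i j : Fin n => Disjoint (arc k i) (arc k j))
      (exists_disjoint_arc hk hkn) (Finset.univ.filter fun i => σ • arc k i ∈ S)
    convert h using 2
    · simp only [f, Finset.sum_boole, Nat.cast_id]
    · simp only [g, Finset.sum_boole, Nat.cast_id, Prod.smul_mk, P]
      congr 1
      ext p
      simp
      tauto
  -- Under a uniform permutation an arc becomes a uniform `k`-set and a disjoint pair of arcs a
  -- uniform disjoint pair.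
  have hf : ∀ i : Fin n, N * ∑ σ : Equiv.Perm (Fin n), f (σ • arc k i) = F * S.card := by
    intro i
    have h := card_mul_sum_smul (G := Equiv.Perm (Fin n))
      ((Finset.univ : Finset (Fin n)).powersetCard k) (x := arc k i)
      (by simp) ?_ f (by simp [card_arc (by omega : k ≤ n)])
    · rw [Finset.card_powersetCard, Finset.card_univ, Fintype.card_fin] at h
      rw [h]
      congr 1
      simp only [f, Finset.sum_boole, Nat.cast_id]
      congr 1
      ext A
      simpa using hS A
    · intro A hA B hB
      obtain ⟨σ, h, -⟩ := exists_perm_smul_pair (A := A) (A' := B) (B := ∅) (B' := ∅)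
        (by simp at hA hB; omega) rfl (by simp) (by simp)
      exact ⟨σ, h⟩
  have hg : ∀ p ∈ P, N * c * ∑ σ : Equiv.Perm (Fin n), g (σ • (arc k p.1, arc k p.2)) =
      F * numDisjoint S := by
    intro p hp
    have h := card_mul_sum_smul (G := Equiv.Perm (Fin n))
      (disjointPairs (Fin n) k) (x := (arc k p.1, arc k p.2))
      ?_ ?_ g (by simpa [mem_disjointPairs, card_arc (by omega : k ≤ n), P] using hp)
    · rw [card_disjointPairs, Fintype.card_fin] at h
      rw [h]
      congr 1
      simp only [g, Finset.sum_boole, Nat.cast_id, numDisjoint]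
      congr 1
      ext ⟨A, B⟩
      simp only [Finset.mem_filter, mem_disjointPairs, Finset.mem_product]
      constructor
      · tauto
      · rintro ⟨⟨h1, h2⟩, h3⟩
        exact ⟨⟨hS _ h1, hS _ h2, h3⟩, h1, h2⟩
    · rintro σ ⟨A, B⟩ hAB
      rw [mem_disjointPairs] at *
      refine ⟨by simpa using hAB.1, by simpa using hAB.2.1, ?_⟩
      simpa [Finset.disjoint_left, Finset.mem_smul_finset] using hAB.2.2
    · rintro ⟨A, B⟩ hA ⟨A', B'⟩ hB
      rw [mem_disjointPairs] at *
      obtain ⟨σ, h1, h2⟩ := exists_perm_smul_pair (hA.1.trans hB.1.symm)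
        (hA.2.1.trans hB.2.1.symm) hA.2.2 hB.2.2
      exact ⟨σ, by simp [h1, h2]⟩
  have total := Finset.sum_le_sum fun σ (_ : σ ∈ Finset.univ) => key σ
  rw [Finset.sum_comm, Finset.sum_add_distrib, Finset.sum_comm (t := P)] at total
  have total' := Nat.mul_le_mul_left (N * c) total
  rw [mul_add, Finset.mul_sum, Finset.mul_sum, Finset.mul_sum (s := P), Finset.sum_congr rfl hg,
    Finset.sum_congr rfl (g := fun _ => c * (F * S.card))
      (fun i _ => by rw [← hf i]; ring)] at total'
  simp only [Finset.sum_const, Finset.card_univ, Fintype.card_fin, smul_eq_mul, hP] at total'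
  refine Nat.le_of_mul_le_mul_left ?_ hcardG
  calc F * (n * S.card * c) = n * (c * (F * S.card)) := by ring
    _ ≤ _ := total'
    _ = _ := by ring

/-- Supersaturation for the Erdős–Ko–Rado theorem. -/
theorem supersaturation {n k : ℕ} (hk : 0 < k) (hkn : 2 * k ≤ n) (S : Finset (Finset (Fin n)))
    (hS : ∀ A ∈ S, A.card = k) :
    S.card * (n - k).choose (k - 1) ≤
      (n - 1).choose (k - 1) * (n - k).choose (k - 1) + k * numDisjoint S := by
  have h := sum_arcs_le hk hkn S hS
  obtain ⟨k, rfl⟩ : ∃ m, k = m + 1 := ⟨k - 1, by omega⟩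
  obtain ⟨n, rfl⟩ : ∃ m, n = m + 1 := ⟨n - 1, by omega⟩
  simp only [Nat.add_sub_cancel] at *
  have h1 : (n + 1) * n.choose k = (n + 1).choose (k + 1) * (k + 1) :=
    Nat.add_one_mul_choose_eq n k
  -- This identity lets the number `q` of arcs disjoint from a given one cancel.
  have h2 := Nat.choose_succ_right_eq (n + 1 - (k + 1)) k
  rw [show n + 1 - (k + 1) - k = n + 1 - 2 * (k + 1) + 1 by omega] at h2
  set q := n + 1 - 2 * (k + 1) + 1
  have hq : 0 < q := by omega
  set c := (n + 1 - (k + 1)).choose (k + 1)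
  set d := (n + 1 - (k + 1)).choose k
  refine le_of_mul_le_mul_left (a := (n + 1) * q) ?_ (by positivity)
  calc (n + 1) * q * (S.card * d) = (n + 1) * S.card * (d * q) := by ring
    _ = (k + 1) * ((n + 1) * S.card * c) := by rw [← h2]; ring
    _ ≤ (k + 1) * ((k + 1) * ((n + 1).choose (k + 1) * c) + (n + 1) * q * numDisjoint S) :=
        Nat.mul_le_mul_left _ h
    _ = ((n + 1).choose (k + 1) * (k + 1)) * (c * (k + 1)) +
          (n + 1) * q * ((k + 1) * numDisjoint S) := by ring
    _ = _ := by rw [← h1, h2]; ring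

/-! ### Counting independent sets by branching -/

/-- The number of independent sets of a graph in which every set of more than `R` vertices has a
vertex of degree at least `δ`. -/
theorem card_independent_le {β : Type*} [DecidableEq β] (r : β → β → Prop) [DecidableRel r]
    {R δ : ℕ} {x : ℝ} (hx : 1 ≤ x) (hδ : x ^ δ + 1 ≤ x ^ (δ + 1)) (A : Finset β)
    (hirr : ∀ v ∈ A, ¬ r v v)
    (hdeg : ∀ S ⊆ A, R < S.card → ∃ v ∈ S, δ ≤ (S.filter fun u => r v u).card) :
    ((A.powerset.filter fun I => ∀ a ∈ I, ∀ b ∈ I, ¬ r a b).card : ℝ) ≤ 2 ^ R * x ^ A.card := by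
  induction A using Finset.strongInduction with
  | H A ih =>
    by_cases hA : A.card ≤ R
    · have h1 : (A.powerset.filter fun I => ∀ a ∈ I, ∀ b ∈ I, ¬ r a b).card ≤ 2 ^ A.card :=
        (Finset.card_filter_le _ _).trans (Finset.card_powerset A).le
      calc ((A.powerset.filter fun I => ∀ a ∈ I, ∀ b ∈ I, ¬ r a b).card : ℝ) ≤ 2 ^ A.card := by
            exact_mod_cast h1
        _ ≤ 2 ^ R := pow_le_pow_right₀ (by norm_num) hA
        _ ≤ 2 ^ R * x ^ A.card := le_mul_of_one_le_right (by positivity) (one_le_pow₀ hx)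
    obtain ⟨v, hv, hvdeg⟩ := hdeg A subset_rfl (by omega)
    set B := A.erase v
    set C := B.filter fun u => ¬ r v u
    have hBA : B ⊂ A := Finset.erase_ssubset hv
    have hCB : C ⊆ B := Finset.filter_subset _ _
    have hCA : C ⊂ A := hCB.trans_ssubset hBA
    have hB := ih B hBA (fun u hu => hirr u (hBA.1 hu)) (fun S hS => hdeg S (hS.trans hBA.1))
    have hC := ih C hCA (fun u hu => hirr u (hCA.1 hu)) (fun S hS => hdeg S (hS.trans hCA.1))
    have hBcard : B.card + 1 = A.card := Finset.card_erase_add_one hv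
    have hCcard : C.card + δ + 1 ≤ A.card := by
      have h1 : (A.filter fun u => r v u) ⊆ B.filter fun u => r v u := by
        intro u hu
        rw [Finset.mem_filter] at hu ⊢
        refine ⟨Finset.mem_erase.2 ⟨?_, hu.1⟩, hu.2⟩
        rintro rfl
        exact hirr _ hv hu.2
      have h2 := Finset.card_le_card h1
      have h3 : (B.filter fun u => r v u).card + C.card = B.card :=
        Finset.card_filter_add_card_filter_not (s := B) (fun u => r v u)
      omega
    -- An independent set either avoids `v` or consists of `v` and a subset of its non-neighbours
    -- `C`.
    have hsplit : (A.powerset.filter fun I => ∀ a ∈ I, ∀ b ∈ I, ¬ r a b).card ≤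
        (B.powerset.filter fun I => ∀ a ∈ I, ∀ b ∈ I, ¬ r a b).card +
        (C.powerset.filter fun I => ∀ a ∈ I, ∀ b ∈ I, ¬ r a b).card := by
      refine (Finset.card_le_card (t := (B.powerset.filter fun I => ∀ a ∈ I, ∀ b ∈ I, ¬ r a b) ∪
        (C.powerset.filter fun I => ∀ a ∈ I, ∀ b ∈ I, ¬ r a b).image (insert v)) ?_).trans
        ((Finset.card_union_le _ _).trans (Nat.add_le_add_left Finset.card_image_le _))
      intro I hI
      simp only [Finset.mem_filter, Finset.mem_powerset, Finset.mem_union, Finset.mem_image] at *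
      by_cases hvI : v ∈ I
      · right
        refine ⟨I.erase v, ⟨?_, ?_⟩, Finset.insert_erase hvI⟩
        · intro u hu
          have hu' := Finset.mem_erase.1 hu
          exact Finset.mem_filter.2
            ⟨Finset.mem_erase.2 ⟨hu'.1, hI.1 hu'.2⟩, hI.2 v hvI u hu'.2⟩
        · exact fun a ha b hb =>
            hI.2 a (Finset.mem_of_mem_erase ha) b (Finset.mem_of_mem_erase hb)
      · left
        refine ⟨fun u hu => Finset.mem_erase.2 ⟨?_, hI.1 hu⟩, hI.2⟩
        rintro rfl
        exact hvI hu
    have hx0 : 0 < x := by linarith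
    obtain ⟨m, hm⟩ : ∃ m, A.card = m + δ + 1 := ⟨A.card - δ - 1, by omega⟩
    have hBe : B.card = m + δ := by omega
    calc ((A.powerset.filter fun I => ∀ a ∈ I, ∀ b ∈ I, ¬ r a b).card : ℝ)
        ≤ 2 ^ R * x ^ B.card + 2 ^ R * x ^ C.card :=
          (by exact_mod_cast hsplit : _ ≤ _).trans (add_le_add hB hC)
      _ ≤ 2 ^ R * x ^ (m + δ) + 2 ^ R * x ^ m := by
          rw [hBe]
          gcongr
          omega
      _ = 2 ^ R * (x ^ m * (x ^ δ + 1)) := by ring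
      _ ≤ 2 ^ R * (x ^ m * x ^ (δ + 1)) := by gcongr
      _ = 2 ^ R * x ^ A.card := by rw [hm]; ring

/-! ### The lower bound -/

theorem numIntersecting_eq (n k : ℕ) :
    numIntersecting n k =
      ((((Finset.univ : Finset (Fin n)).powersetCard k).powerset).filter
        fun I => ∀ a ∈ I, ∀ b ∈ I, ¬ Disjoint a b).card := by
  rw [numIntersecting, ← Set.ncard_coe_finset]
  congr 1
  ext H
  simp [Set.Sized, Set.Intersecting, Finset.subset_iff]

/-- The subfamilies of a star are intersecting. -/
theorem two_pow_le_numIntersecting {n k : ℕ} (hk : 0 < k) (hn : 0 < n) :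
    2 ^ (n - 1).choose (k - 1) ≤ numIntersecting n k := by
  classical
  obtain ⟨n, rfl⟩ : ∃ m, n = m + 1 := ⟨n - 1, by omega⟩
  obtain ⟨k, rfl⟩ : ∃ m, k = m + 1 := ⟨k - 1, by omega⟩
  simp only [Nat.add_sub_cancel]
  let star := ((Finset.univ.erase (0 : Fin (n + 1))).powersetCard k).image (insert 0)
  have hstar : star.card = n.choose k := by
    rw [Finset.card_image_of_injOn, Finset.card_powersetCard]
    · simp
    · intro A hA B hB h
      have h0 : ∀ C ∈ (Finset.univ.erase (0 : Fin (n + 1))).powersetCard k, (0 : Fin (n + 1)) ∉ C :=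
        fun C hC h => by simpa using (Finset.mem_powersetCard.1 hC).1 h
      rw [← Finset.erase_insert (h0 A hA), ← Finset.erase_insert (h0 B hB)]
      exact congrArg (fun C => C.erase 0) h
  rw [numIntersecting_eq, ← hstar, ← Finset.card_powerset]
  apply Finset.card_le_card
  intro H hH
  rw [Finset.mem_powerset] at hH
  have hmem : ∀ A ∈ H, A.card = k + 1 ∧ (0 : Fin (n + 1)) ∈ A := by
    intro A hA
    obtain ⟨B, hB, rfl⟩ := Finset.mem_image.1 (hH hA)
    rw [Finset.mem_powersetCard] at hB
    refine ⟨?_, Finset.mem_insert_self _ _⟩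
    rw [Finset.card_insert_of_notMem (fun h => by simpa using hB.1 h), hB.2]
  simp only [Finset.mem_filter, Finset.mem_powerset]
  refine ⟨fun A hA => by simp [(hmem A hA).1], fun A hA B hB h => ?_⟩
  exact Finset.disjoint_left.1 h (hmem A hA).2 (hmem B hB).2

/-! ### Degree estimates and the upper bound -/

theorem le_choose {m i : ℕ} (hi : 1 ≤ i) (him : i + 1 ≤ m) : m ≤ m.choose i := by
  induction m, him using Nat.le_induction with
  | base => rw [Nat.choose_succ_self_right]
  | succ m hm ih =>
    obtain ⟨j, rfl⟩ : ∃ j, i = j + 1 := ⟨i - 1, by omega⟩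
    have := Nat.choose_pos (n := m) (k := j) (by omega)
    rw [Nat.choose_succ_succ' m j]
    omega

theorem choose_two_le_choose {m j : ℕ} (hj : 2 ≤ j) (hjm : j + 2 ≤ m) :
    m.choose 2 ≤ m.choose j := by
  induction m, hjm using Nat.le_induction with
  | base =>
    rw [show (j + 2).choose j = (j + 2).choose 2 from
      (Nat.choose_symm_of_eq_add (by omega))]
  | succ m hm ih =>
    obtain ⟨i, rfl⟩ : ∃ i, j = i + 1 := ⟨j - 1, by omega⟩
    rw [Nat.choose_succ_succ' m 1, Nat.choose_succ_succ' m i]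
    refine add_le_add ?_ ih
    rw [Nat.choose_one_right]
    exact le_choose (by omega) (by omega)

theorem sq_le_choose {n k : ℕ} (hk : 3 ≤ k) (hkn : 2 * k + 1 ≤ n) :
    (n : ℝ) ^ 2 / 16 ≤ ((n - k).choose (k - 1) : ℝ) := by
  have h1 := choose_two_le_choose (m := n - k) (j := k - 1) (by omega) (by omega)
  have h2 : ((n - k).choose 2 : ℝ) ≤ ((n - k).choose (k - 1) : ℝ) := by exact_mod_cast h1
  refine le_trans ?_ h2
  rw [Nat.cast_choose_two, Nat.cast_sub (by omega)]
  have h3 : (2 : ℝ) * k + 1 ≤ n := by exact_mod_cast hkn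
  have h4 : (3 : ℝ) ≤ k := by exact_mod_cast hk
  nlinarith

/-- A family much larger than a star has a member disjoint from many others. -/
theorem exists_large_degree {n k : ℕ} {η : ℝ} (hη : 0 < η) (hk : 3 ≤ k) (hkn : 2 * k + 1 ≤ n)
    (S : Finset (Finset (Fin n))) (hS : ∀ A ∈ S, A.card = k)
    (hlarge : (1 + η) * (n - 1).choose (k - 1) < S.card) :
    ∃ v ∈ S, η / (1 + η) * (n ^ 2 / (16 * k)) ≤ ((S.filter fun u => Disjoint v u).card : ℝ) := by
  by_contra! hcon
  have hss := supersaturation (by omega : 0 < k) (by omega) S hS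
  have hnum : numDisjoint S = ∑ v ∈ S, (S.filter fun u => Disjoint v u).card := by
    simp only [numDisjoint, Finset.card_filter, Finset.sum_product]
  have hM : (0 : ℝ) ≤ (n - 1).choose (k - 1) := by positivity
  have hSpos : (0 : ℝ) < S.card := lt_of_le_of_lt (by positivity) hlarge
  have hne : S.Nonempty := Finset.card_pos.1 (by exact_mod_cast hSpos)
  have h1 : (numDisjoint S : ℝ) < S.card * (η / (1 + η) * (n ^ 2 / (16 * k))) := by
    rw [hnum, Nat.cast_sum, ← nsmul_eq_mul]
    exact (Finset.sum_lt_sum_of_nonempty hne hcon).trans_eq (by simp)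
  have h2 : (S.card : ℝ) * (n - k).choose (k - 1) ≤
      (n - 1).choose (k - 1) * (n - k).choose (k - 1) + k * numDisjoint S := by
    exact_mod_cast hss
  have h3 := sq_le_choose hk hkn
  have hk0 : (0 : ℝ) < k := by exact_mod_cast (by omega : 0 < k)
  set D : ℝ := (((n - k).choose (k - 1) : ℕ) : ℝ)
  set M : ℝ := (((n - 1).choose (k - 1) : ℕ) : ℝ)
  set s : ℝ := (S.card : ℝ)
  have h4 : k * (numDisjoint S : ℝ) < s * (η / (1 + η)) * (n ^ 2 / 16) := by
    calc k * (numDisjoint S : ℝ) < k * (s * (η / (1 + η) * (n ^ 2 / (16 * k)))) := by gcongr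
      _ = _ := by field_simp
  -- Since M < s/(1+η), the excess over a star is a fixed fraction of s.
  have h5 : s * (η / (1 + η)) ≤ s - M := by
    rw [mul_div_assoc', div_le_iff₀ (by linarith)]
    nlinarith
  have hD : 0 ≤ D := by positivity
  have h6 : s * (η / (1 + η)) * (n ^ 2 / 16) ≤ (s - M) * D := by
    have : 0 ≤ s * (η / (1 + η)) := by positivity
    gcongr
    exact this.trans h5
  nlinarith

/-- The claim amounts to t(1+t)^(2m) ≥ 1. Squaring Bernoulli matters: applied directly it would need
mt² of order 1, but in the application mt² is a small constant times k, whereas m²t³ grows like nk.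
-/
theorem one_add_pow_condition {t : ℝ} {m : ℕ} (ht : 0 ≤ t) (h : 1 ≤ (m : ℝ) ^ 2 * t ^ 3) :
    (1 + t) ^ (2 * m) + 1 ≤ (1 + t) ^ (2 * m + 1) := by
  have h1 : 1 + m * t ≤ (1 + t) ^ m := one_add_mul_le_pow (by linarith) m
  have h2 : (m * t) ^ 2 ≤ (1 + t) ^ (2 * m) := by
    rw [mul_comm 2 m, pow_mul]
    exact pow_le_pow_left₀ (by positivity) (by linarith) 2
  have h3 : (m * t) ^ 2 * t ≤ (1 + t) ^ (2 * m) * t := by gcongr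
  rw [pow_succ]
  nlinarith

theorem numIntersecting_le {ε : ℝ} (hε : 0 < ε) : ∃ n₀ : ℕ, ∀ n k : ℕ, n₀ ≤ n → 3 ≤ k →
    2 * k + 1 ≤ n →
      Real.logb 2 (numIntersecting n k) ≤ (1 + ε) * ((n - 1).choose (k - 1) : ℝ) := by
  -- The error splits as η + 2τ = ε; the 2 comes from log₂(1+t) ≤ 2t.
  set η := ε / 2 with hηdef
  set τ := ε / 4 with hτdef
  have hη : 0 < η := by positivity
  have hτ : 0 < τ := by positivity
  set c := η / (1 + η)
  have hc : 0 < c := by positivity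
  obtain ⟨n₁, hn₁⟩ := exists_nat_ge (4096 / (c ^ 2 * τ ^ 3))
  obtain ⟨n₂, hn₂⟩ := exists_nat_ge (64 / c)
  refine ⟨max n₁ n₂, fun n k hn hk hkn => ?_⟩
  have hnn₁ : 4096 / (c ^ 2 * τ ^ 3) ≤ n := hn₁.trans (by exact_mod_cast (le_max_left _ _).trans hn)
  have hnn₂ : 64 / c ≤ n := hn₂.trans (by exact_mod_cast (le_max_right _ _).trans hn)
  rw [div_le_iff₀ (by positivity)] at hnn₁ hnn₂
  have hk0 : (3 : ℝ) ≤ k := by exact_mod_cast hk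
  have hkn' : (2 : ℝ) * k + 1 ≤ n := by exact_mod_cast hkn
  have hn0 : (0 : ℝ) < n := by linarith
  set M : ℝ := (((n - 1).choose (k - 1) : ℕ) : ℝ)
  have hM : 0 ≤ M := by positivity
  -- Chosen so that C(n,k)·t = τM.
  set t : ℝ := τ * k / n with htdef
  have ht : 0 < t := by positivity
  set δ₀ : ℝ := c * (n ^ 2 / (16 * k)) with hδ₀
  have hδ₀4 : 4 ≤ δ₀ := by
    rw [hδ₀, mul_div_assoc', le_div_iff₀ (by positivity)]
    nlinarith
  -- As δ₀ ≥ 4, rounding up still leaves 2m ≤ δ₀.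
  set m := ⌈δ₀ / 4⌉₊
  have hm1 : δ₀ / 4 ≤ m := Nat.le_ceil _
  have hm2 : (m : ℝ) < δ₀ / 4 + 1 := Nat.ceil_lt_add_one (by positivity)
  have hcond : 1 ≤ (m : ℝ) ^ 2 * t ^ 3 := by
    calc (1 : ℝ) ≤ (δ₀ / 4) ^ 2 * t ^ 3 := by
          have : (δ₀ / 4) ^ 2 * t ^ 3 = (n * (c ^ 2 * τ ^ 3)) * k / 4096 := by
            rw [hδ₀, htdef]
            field_simp
            norm_num
          rw [this, le_div_iff₀ (by norm_num)]
          nlinarith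
      _ ≤ (m : ℝ) ^ 2 * t ^ 3 := by gcongr
  set R := ⌊(1 + η) * M⌋₊
  have hcount := card_independent_le (fun A B : Finset (Fin n) => Disjoint A B) (R := R)
    (δ := 2 * m) (x := 1 + t) (by linarith) (one_add_pow_condition ht.le hcond)
    ((Finset.univ : Finset (Fin n)).powersetCard k) ?_ ?_
  · replace hcount : (numIntersecting n k : ℝ) ≤ 2 ^ R * (1 + t) ^ n.choose k := by
      rw [numIntersecting_eq]
      rw [Finset.card_powersetCard, Finset.card_univ, Fintype.card_fin] at hcount
      convert hcount
    have hpos : (0 : ℝ) < numIntersecting n k := by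
      have := two_pow_le_numIntersecting (n := n) (k := k) (by omega) (by omega)
      exact_mod_cast lt_of_lt_of_le (by positivity) this
    have hNM : (n : ℝ) * M = n.choose k * k := by
      have := Nat.add_one_mul_choose_eq (n - 1) (k - 1)
      rw [Nat.sub_add_cancel (by omega), Nat.sub_add_cancel (by omega)] at this
      have := congrArg (Nat.cast (R := ℝ)) this
      rwa [Nat.cast_mul, Nat.cast_mul] at this
    have hNt : (n.choose k : ℝ) * t = τ * M := by
      rw [htdef]
      field_simp
      linarith
    have hlog2 : (1 / 2 : ℝ) ≤ Real.log 2 := by linarith [Real.log_two_gt_d9]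
    have hlogt : Real.logb 2 (1 + t) ≤ 2 * t := by
      rw [Real.logb, div_le_iff₀ (by linarith)]
      have := Real.log_le_sub_one_of_pos (by linarith : 0 < 1 + t)
      nlinarith
    have hR : (R : ℝ) ≤ (1 + η) * M := Nat.floor_le (by positivity)
    calc Real.logb 2 (numIntersecting n k)
        ≤ Real.logb 2 (2 ^ R * (1 + t) ^ n.choose k) :=
          Real.logb_le_logb_of_le (by norm_num) hpos hcount
      _ = R + n.choose k * Real.logb 2 (1 + t) := by
          rw [Real.logb_mul (by positivity) (by positivity), Real.logb_pow, Real.logb_pow,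
            Real.logb_self_eq_one (by norm_num), mul_one]
      _ ≤ (1 + η) * M + n.choose k * (2 * t) := by gcongr
      _ = (1 + ε) * M := by
          rw [mul_left_comm, hNt, hηdef, hτdef]
          ring
  · intro v hv h
    rw [disjoint_self, Finset.bot_eq_empty] at h
    simp [h] at hv
    omega
  · intro S hS hRS
    obtain ⟨v, hv, hdeg⟩ := exists_large_degree hη hk hkn S
      (fun A hA => (Finset.mem_powersetCard.1 (hS hA)).2) (Nat.lt_of_floor_lt hRS)
    refine ⟨v, hv, ?_⟩
    have : ((2 * m : ℕ) : ℝ) ≤ ((S.filter fun u => Disjoint v u).card : ℝ) := by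
      push_cast
      linarith
    exact_mod_cast this

/-- Here the error term `o(1)` tends to `0` as `n → ∞`, uniformly in `k` with `3 ≤ k` and
`2 * k + 1 ≤ n`, and the logarithm is to base `2`. -/
theorem theorem1p5 :
    ∀ ε : ℝ, 0 < ε → ∃ n₀ : ℕ, ∀ n k : ℕ, n₀ ≤ n → 3 ≤ k → 2 * k + 1 ≤ n →
      |Real.logb 2 (numIntersecting n k : ℝ) - ((n - 1).choose (k - 1) : ℝ)|
        ≤ ε * ((n - 1).choose (k - 1) : ℝ) := by
  intro ε hε
  obtain ⟨n₀, h⟩ := numIntersecting_le hε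
  refine ⟨n₀, fun n k hn hk hkn => ?_⟩
  have hupper := h n k hn hk hkn
  have hlower : ((n - 1).choose (k - 1) : ℝ) ≤ Real.logb 2 (numIntersecting n k) := by
    have hpow := two_pow_le_numIntersecting (n := n) (k := k) (by omega) (by omega)
    have hpos : 0 < numIntersecting n k := lt_of_lt_of_le (by positivity) hpow
    rw [Real.le_logb_iff_rpow_le (by norm_num) (by exact_mod_cast hpos), Real.rpow_natCast]
    exact_mod_cast hpow
  rw [abs_of_nonneg (by linarith)]
  linarith
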